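/- Let $d\ge 3$. There is a constant $k_d>0$ depending only on $d$ such that the following holds for every $n\ge 1$ for which a $d$-regular simple graph on the vertex set $[n]$ exists. Let $G$ be drawn uniformly at random from the $d$-regular simple graphs on $[n]$. Let $\mathcal A$ be any (possibly randomized and adaptive) algorithm which at each step, depending on the steps and answers so far and on its own randomness, either halts, or makes a $\mathrm{rand\_neighbor}(v)$ probe for a vertex $v$ of its choice (answered by a fresh uniformly random neighbor of $v$ in $G$), or makes a $\mathrm{rand\_vertex}$ probe (answered by a fresh uniformly random vertex of $G$), or marks a vertex of its choice. Every vertex touched by a probe (the vertex probed and the vertex returned) is marked as well. Suppose that $\mathcal A$ makes at most $\sqrt n/k_d$ steps (probes and markings together). Then, with probability at least $0.995$ over $G$, the answers and the randomness of $\mathcal A$, both of the following hold: 1. the graph formed by the set of edges $\{v,w\}$ revealed by the $\mathrm{rand\_neighbor}$ probes ($w$ being returned for a probe at $v$) is a forest; 2. no $\mathrm{rand\_neighbor}$ probe ever merges two marked trees: whenever a probe at $v$ returns a vertex $w$ that was already marked before this probe, $v$ and $w$ already lie in the same connected component of the graph of the edges revealed before this probe. (The probed vertex $v$ counts as marked from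 the moment it is probed, so a vertex not marked before is a tree of its own; re-tracing a revealed edge is not a merge.) -/

import Mathlib

open scoped ENNReal

namespace RegProbe

/-- The `d`-regular simple graphs on the labelled vertex set `Fin n`. -/
noncomputable def regularGraphs (n d : ℕ) : Finset (SimpleGraph (Fin n)) :=
  open Classical in Finset.univ.filter fun G => G.IsRegularOfDegree d

/-- What an algorithm may ask for in one step: a random neighbor of `v`, a random vertex,
or that the vertex `v` be marked. -/
inductive Op (n : ℕ) : Type
  | randNeighbor (v : Fin n)
  | randVertex
  | mark (v : Fin n)

/-- One performed step, with its answer: `randNeighbor v w` means that a random neighbor of `v`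
was requested and `w` was returned; `randVertex w` means that the random vertex returned is `w`. -/
inductive Step (n : ℕ) : Type
  | randNeighbor (v w : Fin n)
  | randVertex (w : Fin n)
  | mark (v : Fin n)

/-- The list of steps performed so far, the most recent one first. -/
abbrev Transcript (n : ℕ) : Type := List (Step n)

/-- A randomized, adaptive algorithm: from the transcript so far it draws its next request
at random; `none` means that it halts (for good). It has no other access to the graph. -/
abbrev Algorithm (n : ℕ) : Type := Transcript n → PMF (Option (Op n))

/-- The random answer of the graph `G` to one request. -/
noncomputable def answer {n : ℕ} [NeZero n] (G : SimpleGraph (Fin n)) : Op n → PMF (Step n)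
  | .randNeighbor v =>
      open Classical in
      -- The second branch concerns isolated vertices only; these do not occur for degree `d ≥ 1`.
      if hv : (G.neighborFinset v).Nonempty then
        (PMF.uniformOfFinset (G.neighborFinset v) hv).map (Step.randNeighbor v)
      else PMF.pure (.mark v)
  | .randVertex => (PMF.uniformOfFintype (Fin n)).map Step.randVertex
  | .mark v => PMF.pure (.mark v)

/-- The law of the transcript when the algorithm `A` is run on the graph `G` for at most `q`
further steps (fewer if it halts), from the transcript `h` on. -/
noncomputable def runFrom {n : ℕ} [NeZero n] (A : Algorithm n) (G : SimpleGraph (Fin n)) :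
    ℕ → Transcript n → PMF (Transcript n)
  | 0, h => PMF.pure h
  | q + 1, h => (A h).bind fun o =>
      match o with
      | none => PMF.pure h
      | some a => (answer G a).bind fun s => runFrom A G q (s :: h)

/-- The law of the transcript of at most `q` steps of `A` on a uniformly random `d`-regular
graph on `n` vertices. -/
noncomputable def transcriptLaw (n d : ℕ) [NeZero n] (hne : (regularGraphs n d).Nonempty)
    (A : Algorithm n) (q : ℕ) : PMF (Transcript n) :=
  (PMF.uniformOfFinset (regularGraphs n d) hne).bind fun G => runFrom A G q []

/-- The vertices that a step touches, all of which become marked. -/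
def Step.touched {n : ℕ} : Step n → Set (Fin n)
  | .randNeighbor v w => {v, w}
  | .randVertex w => {w}
  | .mark v => {v}

/-- The vertices marked during a transcript. -/
def marked {n : ℕ} (h : Transcript n) : Set (Fin n) :=
  {x | ∃ s ∈ h, x ∈ s.touched}

/-- The graph whose edges are those revealed by the random-neighbor probes of a transcript. -/
def revealed {n : ℕ} (h : Transcript n) : SimpleGraph (Fin n) :=
  SimpleGraph.fromRel fun v w => Step.randNeighbor v w ∈ h

/-- A random-neighbor probe at `v` answered by `w`, made after the transcript `h`, merges two
marked trees. The trees are the connected components of the revealed graph that consist of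
marked vertices (possibly a single one). The probed vertex `v` is touched by the probe and so
counts as marked, whether or not it was marked before; the probe merges two trees if `w` was
marked already and lies in another component than `v`. -/
def Merges {n : ℕ} (h : Transcript n) (v w : Fin n) : Prop :=
  w ∈ marked h ∧ ¬ (revealed h).Reachable v w

/-- No random-neighbor probe of the transcript merged two marked trees when it was made. -/
def NeverMerges {n : ℕ} (h : Transcript n) : Prop :=
  ∀ (h₀ : Transcript n) (v w : Fin n), (Step.randNeighbor v w :: h₀) <:+ h → ¬ Merges h₀ v w

end RegProbe

/-!
Reveal the edges of `G` only as they are probed: given a transcript, `G` is uniform among the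
`d`-regular graphs that contain the revealed graph `F`. For vertices `v`, `w` not joined in `F`,
switching `vw` with another unrevealed edge maps the graphs that contain `F ⊔ edge v w` to graphs
that contain `F`, and counting these switchings shows that the edge `vw` is present with conditional
probability at most `8 * d / n`. (In the dense range `n ≤ 8 * d` this is no restriction.) A probe at
`v` follows a given edge with probability `1 / d`, and at most `2 * q` vertices are ever marked, so
each of the `q` steps closes a cycle or merges two trees with probability at most `16 * q / n`.
-/

open scoped Finset

namespace RegProbe

section Switching

open SimpleGraph

variable {V : Type*} {F G : SimpleGraph V} {v w x y : V}

/-- Switching: the edges `vw` and `xy` of `G` are replaced by `vx` and `wy`. It is meant for pairs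
with `Switchable G v w x y`. -/
def switch (G : SimpleGraph V) (v w x y : V) : SimpleGraph V :=
  G \ (edge v w ⊔ edge x y) ⊔ (edge v x ⊔ edge w y)

/-- The edges `vw` and `xy` of `G`, each with the given orientation, can be switched to `vx` and
`wy`: this produces neither a loop nor a double edge. -/
structure Switchable (G : SimpleGraph V) (v w x y : V) : Prop where
  adj_left : G.Adj v w
  adj_right : G.Adj x y
  ne_left : v ≠ x
  ne_right : w ≠ y
  not_adj_left : ¬ G.Adj v x
  not_adj_right : ¬ G.Adj w y

theorem switch_comm (G : SimpleGraph V) (v w x y : V) : switch G v w x y = switch G x y v w := by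
  simp only [switch, edge_comm v x, edge_comm w y, sup_comm]

theorem switch_flip (G : SimpleGraph V) (v w x y : V) : switch G v w x y = switch G w v y x := by
  simp only [switch, edge_comm v w, edge_comm x y, sup_comm]

theorem Switchable.comm (h : Switchable G v w x y) : Switchable G x y v w :=
  ⟨h.adj_right, h.adj_left, h.ne_left.symm, h.ne_right.symm, mt .symm h.not_adj_left,
    mt .symm h.not_adj_right⟩

theorem Switchable.flip (h : Switchable G v w x y) : Switchable G w v y x :=
  ⟨h.adj_left.symm, h.adj_right.symm, h.ne_right, h.ne_left, h.not_adj_right, h.not_adj_left⟩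

theorem Switchable.switch_switch (h : Switchable G v w x y) :
    switch (switch G v w x y) v x w y = G := by
  have hle : edge v w ⊔ edge x y ≤ G :=
    sup_le ((edge_le_iff G).2 (.inr h.adj_left)) ((edge_le_iff G).2 (.inr h.adj_right))
  have hdisj : Disjoint G (edge v x ⊔ edge w y) :=
    disjoint_sup_right.2
      ⟨(disjoint_edge _).2 h.not_adj_left, (disjoint_edge _).2 h.not_adj_right⟩
  rw [switch, switch, sup_sdiff_right_self, (hdisj.mono_left sdiff_le).sdiff_eq_left,
    sdiff_sup_cancel hle]

theorem switch_adj {a b : V} : (switch G v w x y).Adj a b ↔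
    (G.Adj a b ∧ s(a, b) ≠ s(v, w) ∧ s(a, b) ≠ s(x, y)) ∨
      a ≠ b ∧ (s(a, b) = s(v, x) ∨ s(a, b) = s(w, y)) := by
  simp only [switch, sup_adj, sdiff_adj, edge_adj, Sym2.eq_iff, ne_eq]
  grind [G.ne_of_adj]

theorem Switchable.switch_adj_left (h : Switchable G v w x y) : (switch G v w x y).Adj v x :=
  switch_adj.2 (.inr ⟨h.ne_left, .inl rfl⟩)

theorem Switchable.switch_adj_right (h : Switchable G v w x y) : (switch G v w x y).Adj w y :=
  switch_adj.2 (.inr ⟨h.ne_right, .inr rfl⟩)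

theorem le_switch (hFG : F ≤ G) (hvw : ¬ F.Adj v w) (hxy : ¬ F.Adj x y) :
    F ≤ switch G v w x y :=
  le_sup_of_le_left <| le_sdiff.2 ⟨hFG,
    disjoint_sup_right.2 ⟨(disjoint_edge _).2 hvw, (disjoint_edge _).2 hxy⟩⟩

variable [Fintype V]

open Classical in
theorem Switchable.degree_switch_left (h : Switchable G v w x y) :
    (switch G v w x y).degree v = G.degree v := by
  have hN : (switch G v w x y).neighborFinset v = insert x ((G.neighborFinset v).erase w) := by
    ext b
    simp only [mem_neighborFinset, switch_adj, Finset.mem_insert, Finset.mem_erase, Sym2.eq_iff]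
    grind [adj_comm, h.adj_left, h.adj_right, h.adj_left.ne, h.ne_left, h.not_adj_left]
  rw [← card_neighborFinset_eq_degree, hN, Finset.card_insert_of_notMem,
    Finset.card_erase_add_one, card_neighborFinset_eq_degree]
  · simpa using h.adj_left
  · simp [h.not_adj_left]

open Classical in
theorem Switchable.degree_switch (h : Switchable G v w x y) (u : V) :
    (switch G v w x y).degree u = G.degree u := by
  by_cases hv : u = v
  · exact hv ▸ h.degree_switch_left
  by_cases hw : u = w
  · rw [hw, ← h.flip.degree_switch_left]
    congr! 1
    exact switch_flip ..
  by_cases hx : u = x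
  · rw [hx, ← h.comm.degree_switch_left]
    congr! 1
    exact switch_comm ..
  by_cases hy : u = y
  · rw [hy, ← h.comm.flip.degree_switch_left]
    congr! 1
    rw [switch_comm, switch_flip]
  · have hN : (switch G v w x y).neighborFinset u = G.neighborFinset u := by
      ext b
      simp [switch_adj, hv, hw, hx, hy]
    rw [← card_neighborFinset_eq_degree, hN, card_neighborFinset_eq_degree]

open Classical in
theorem card_adj_pairs_fst_mem (G : SimpleGraph V) (S : Finset V) :
    #{p : V × V | G.Adj p.1 p.2 ∧ p.1 ∈ S} = ∑ a ∈ S, G.degree a := by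
  have : ({p : V × V | G.Adj p.1 p.2 ∧ p.1 ∈ S} : Finset (V × V)) =
      (S.sigma fun a => G.neighborFinset a).map (Equiv.sigmaEquivProd V V).toEmbedding := by
    ext ⟨a, b⟩
    simp [and_comm]
  rw [this, Finset.card_map, Finset.card_sigma]
  simp only [card_neighborFinset_eq_degree]

open Classical in
theorem card_adj_pairs (G : SimpleGraph V) :
    #{p : V × V | G.Adj p.1 p.2} = 2 * G.edgeSet.ncard := by
  rw [Set.ncard_eq_toFinset_card', ← edgeFinset,
    ← sum_degrees_eq_twice_card_edges, ← card_adj_pairs_fst_mem]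
  simp

open Classical in
theorem card_mul_le_card_switchable_add {d : ℕ} (hG : G.IsRegularOfDegree d)
    (F : SimpleGraph V) (hvw : G.Adj v w) :
    Fintype.card V * d ≤ #{p : V × V | Switchable G v w p.1 p.2 ∧ ¬ F.Adj p.1 p.2} +
      2 * F.edgeSet.ncard + 2 * ((d + 1) * d) := by
  let closedNbhd (u : V) : Finset V := insert u (G.neighborFinset u)
  let near (u : V) : Finset (V × V) := {p | G.Adj p.1 p.2 ∧ p.1 ∈ closedNbhd u}
  have card_near (u : V) : #(near u) = (d + 1) * d := by
    rw [card_adj_pairs_fst_mem, Finset.sum_congr rfl fun a _ => hG.degree_eq a, Finset.sum_const,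
      smul_eq_mul, Finset.card_insert_of_notMem (by simp),
      card_neighborFinset_eq_degree, hG.degree_eq]
  have card_all : #{p : V × V | G.Adj p.1 p.2} = Fintype.card V * d := by
    simpa [hG.degree_eq] using card_adj_pairs_fst_mem G Finset.univ
  have cover : ({p | G.Adj p.1 p.2} : Finset (V × V)) ⊆
      ({p | Switchable G v w p.1 p.2 ∧ ¬ F.Adj p.1 p.2} : Finset (V × V)) ∪
        ({p | F.Adj p.1 p.2} : Finset (V × V)) ∪ near v ∪
        (near w).map (Equiv.prodComm V V).toEmbedding := by
    rintro ⟨x, y⟩ hxy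
    have hxy : G.Adj x y := by simpa using hxy
    by_cases hF : F.Adj x y
    · simp [hF]
    by_cases hx : x ∈ closedNbhd v
    · simp [near, hx, hxy]
    by_cases hy : y ∈ closedNbhd w
    · simp [near, hy, hxy.symm]
    simp only [closedNbhd, Finset.mem_insert, mem_neighborFinset, not_or] at hx hy
    have : Switchable G v w x y := ⟨hvw, hxy, Ne.symm hx.1, Ne.symm hy.1, hx.2, hy.2⟩
    simp [this, hF]
  calc
    Fintype.card V * d = _ := card_all.symm
    _ ≤ _ := Finset.card_le_card cover
    _ ≤ _ := (Finset.card_union_le _ _).trans <| Nat.add_le_add_right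
        ((Finset.card_union_le _ _).trans <| Nat.add_le_add_right (Finset.card_union_le _ _) _) _
    _ = _ := by rw [Finset.card_map, card_near, card_near, card_adj_pairs]; ring

end Switching

section Extensions

open SimpleGraph

variable {V : Type*} [Fintype V] {d : ℕ} {F G : SimpleGraph V} {v w : V}

/-- The `d`-regular graphs that contain the graph `F`; these are the graphs still possible once the
edges of `F` have been revealed. -/
noncomputable def regularExtensions (d : ℕ) (F : SimpleGraph V) : Finset (SimpleGraph V) :=
  open Classical in {G | G.IsRegularOfDegree d ∧ F ≤ G}

theorem mem_regularExtensions [G.LocallyFinite] :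
    G ∈ regularExtensions d F ↔ G.IsRegularOfDegree d ∧ F ≤ G := by
  simp only [regularExtensions, Finset.mem_filter, Finset.mem_univ, true_and]
  congr!

theorem regularGraphs_eq_regularExtensions_bot {n : ℕ} :
    regularGraphs n d = regularExtensions d (⊥ : SimpleGraph (Fin n)) := by
  ext
  simp [regularGraphs, regularExtensions]

theorem mem_regularExtensions_sup_edge (hvw : v ≠ w) :
    G ∈ regularExtensions d (F ⊔ edge v w) ↔
      G ∈ regularExtensions d F ∧ G.Adj v w := by
  classical
  simp [mem_regularExtensions, hvw, and_assoc]

theorem regularExtensions_anti {F' : SimpleGraph V} (h : F ≤ F') :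
    regularExtensions d F' ⊆ regularExtensions d F := by
  classical
  intro G hG
  rw [mem_regularExtensions] at hG ⊢
  exact ⟨hG.1, h.trans hG.2⟩

/-- Double counting of the switchings that destroy the edge `vw` and preserve `F`. -/
theorem card_regularExtensions_sup_edge_mul_le (hvw : v ≠ w) (hF : ¬ F.Adj v w) {m : ℕ}
    (hm : m + 2 * F.edgeSet.ncard + 2 * ((d + 1) * d) ≤ Fintype.card V * d) :
    #(regularExtensions d (F ⊔ edge v w)) * m ≤ #(regularExtensions d F) * (d * d) := by
  classical
  let S := (regularExtensions d (F ⊔ edge v w)).sigma fun G =>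
    ({p | Switchable G v w p.1 p.2 ∧ ¬ F.Adj p.1 p.2} : Finset (V × V))
  let T := (regularExtensions d F).sigma fun G => G.neighborFinset v ×ˢ G.neighborFinset w
  have card_S : #(regularExtensions d (F ⊔ edge v w)) * m ≤ #S := by
    rw [Finset.card_sigma, ← smul_eq_mul]
    refine Finset.card_nsmul_le_sum _ _ _ fun G hG => ?_
    rw [mem_regularExtensions_sup_edge hvw, mem_regularExtensions] at hG
    have := card_mul_le_card_switchable_add hG.1.1 F hG.2
    lia
  have card_T : #T = #(regularExtensions d F) * (d * d) := by
    rw [Finset.card_sigma]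
    refine Finset.sum_const_nat fun G hG => ?_
    simp [(mem_regularExtensions.1 hG).1.degree_eq]
  let f (t : (_ : SimpleGraph V) × V × V) : (_ : SimpleGraph V) × V × V :=
    ⟨switch t.1 v w t.2.1 t.2.2, t.2⟩
  have f_mapsTo : Set.MapsTo f S T := by
    rintro ⟨G, x, y⟩ ht
    simp only [S, T, f, Finset.mem_coe, Finset.mem_sigma, Finset.mem_filter, Finset.mem_univ,
      true_and, mem_regularExtensions_sup_edge hvw, mem_regularExtensions, Finset.mem_product,
      mem_neighborFinset] at ht ⊢
    obtain ⟨⟨⟨hreg, hle⟩, -⟩, hsw, hxy⟩ := ht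
    exact ⟨⟨fun u => (hsw.degree_switch u).trans (hreg u), le_switch hle hF hxy⟩,
      hsw.switch_adj_left, hsw.switch_adj_right⟩
  have f_injOn : Set.InjOn f S := by
    rintro ⟨G, p⟩ hG ⟨H, p'⟩ hH hGH
    simp only [S, Finset.mem_coe, Finset.mem_sigma, Finset.mem_filter, Finset.mem_univ,
      true_and] at hG hH
    simp only [f, Sigma.mk.injEq, heq_eq_eq] at hGH
    obtain ⟨hGH, rfl⟩ := hGH
    rw [← hG.2.1.switch_switch, hGH, hH.2.1.switch_switch]
  exact card_S.trans ((Finset.card_le_card_of_injOn f f_mapsTo f_injOn).trans card_T.le)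

theorem card_mul_card_regularExtensions_sup_edge_le (hd : 0 < d) (hvw : v ≠ w)
    (hF : ¬ F.Adj v w) (hcard : 16 * F.edgeSet.ncard ≤ Fintype.card V) :
    Fintype.card V * #(regularExtensions d (F ⊔ edge v w)) ≤
      8 * (d * #(regularExtensions d F)) := by
  rcases le_or_gt (Fintype.card V) (8 * d) with hdense | hsparse
  · calc
      _ ≤ 8 * d * #(regularExtensions d F) :=
        Nat.mul_le_mul hdense (Finset.card_le_card (regularExtensions_anti le_sup_left))
      _ = _ := by ring
  · have hcard' : Fintype.card V ≤ Fintype.card V * d := Nat.le_mul_of_pos_right _ hd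
    have hsparse' : 8 * d * d ≤ Fintype.card V * d := Nat.mul_le_mul_right d hsparse.le
    have : 2 * ((d + 1) * d) ≤ 4 * d * d := by nlinarith
    obtain ⟨m, hm⟩ : ∃ m, m + 2 * F.edgeSet.ncard + 2 * ((d + 1) * d) = Fintype.card V * d :=
      ⟨Fintype.card V * d - 2 * F.edgeSet.ncard - 2 * ((d + 1) * d), by lia⟩
    have hm' : Fintype.card V * d ≤ 8 * m := by lia
    have := card_regularExtensions_sup_edge_mul_le hvw hF hm.le
    refine Nat.le_of_mul_le_mul_left ?_ hd
    calc
      _ = #(regularExtensions d (F ⊔ edge v w)) * (Fintype.card V * d) := by ring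
      _ ≤ #(regularExtensions d (F ⊔ edge v w)) * (8 * m) := Nat.mul_le_mul_left _ hm'
      _ = 8 * (#(regularExtensions d (F ⊔ edge v w)) * m) := by ring
      _ ≤ 8 * (#(regularExtensions d F) * (d * d)) := Nat.mul_le_mul_left _ this
      _ = _ := by ring

open Classical in
theorem sum_regularExtensions_sum_neighborFinset [DecidableEq V] {M : Type*} [AddCommMonoid M]
    (d : ℕ) (F : SimpleGraph V) (v : V) (Y : SimpleGraph V → V → M) :
    ∑ G ∈ regularExtensions d F, ∑ w ∈ G.neighborFinset v, Y G w =
      ∑ w ∈ Finset.univ.erase v, ∑ G ∈ regularExtensions d (F ⊔ edge v w), Y G w := by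
  refine Finset.sum_comm' fun G w => ?_
  by_cases hvw : v = w
  · simp [hvw]
  · simp [mem_regularExtensions_sup_edge hvw, Ne.symm hvw]

open Classical in
theorem sum_card_regularExtensions_sup_edge [DecidableEq V] (d : ℕ) (F : SimpleGraph V) (v : V) :
    ∑ w ∈ Finset.univ.erase v, #(regularExtensions d (F ⊔ edge v w)) =
      d * #(regularExtensions d F) := by
  calc
    _ = ∑ w ∈ Finset.univ.erase v, ∑ _G ∈ regularExtensions d (F ⊔ edge v w), 1 := by simp
    _ = ∑ G ∈ regularExtensions d F, ∑ _w ∈ G.neighborFinset v, 1 :=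
      (sum_regularExtensions_sum_neighborFinset ..).symm
    _ = ∑ _G ∈ regularExtensions d F, d := Finset.sum_congr rfl fun G hG => by
      simpa using (mem_regularExtensions.1 hG).1 v
    _ = d * #(regularExtensions d F) := by rw [Finset.sum_const, smul_eq_mul, mul_comm]

open Classical in
/-- A graph `G` that contains `F` and a neighbor `w` of `v` in it are the same data as a vertex
`w ≠ v` and a graph that contains `F ⊔ edge v w`: it suffices to bound the sum for each `w`. -/
theorem sum_regularExtensions_sum_neighborFinset_le {M : Finset V} {g : SimpleGraph V → V → ℝ≥0∞}
    {b p : ℝ≥0∞} (hg : ∀ G w, g G w ≤ 1)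
    (hsafe : ∀ w, v ≠ w → (w ∈ M → F.Adj v w) →
      ∑ G ∈ regularExtensions d (F ⊔ edge v w), g G w ≤
        b * #(regularExtensions d (F ⊔ edge v w)))
    (hrare : ∀ w, v ≠ w → ¬ F.Adj v w →
      (#(regularExtensions d (F ⊔ edge v w)) : ℝ≥0∞) ≤ p * (d * #(regularExtensions d F))) :
    ∑ G ∈ regularExtensions d F, ∑ w ∈ G.neighborFinset v, g G w ≤
      d * ((b + #M * p) * #(regularExtensions d F)) := by
  have hbound : ∀ w ∈ Finset.univ.erase v,
      ∑ G ∈ regularExtensions d (F ⊔ edge v w), g G w ≤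
        b * #(regularExtensions d (F ⊔ edge v w)) +
          if w ∈ M then p * (d * #(regularExtensions d F)) else 0 := by
    intro w hw
    have hvw : v ≠ w := (Finset.ne_of_mem_erase hw).symm
    by_cases hknown : w ∈ M → F.Adj v w
    · exact (hsafe w hvw hknown).trans le_self_add
    · rw [Classical.not_imp] at hknown
      rw [if_pos hknown.1]
      calc
        _ ≤ ∑ _G ∈ regularExtensions d (F ⊔ edge v w), (1 : ℝ≥0∞) :=
          Finset.sum_le_sum fun G _ => hg G w
        _ = #(regularExtensions d (F ⊔ edge v w)) := by simp
        _ ≤ _ := (hrare w hvw hknown.2).trans le_add_self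
  have hmarked : (∑ w ∈ Finset.univ.erase v,
      if w ∈ M then p * (d * #(regularExtensions d F)) else 0) ≤
        #M * (p * (d * #(regularExtensions d F))) := by
    rw [← Finset.sum_filter, Finset.sum_const, nsmul_eq_mul]
    gcongr
    exact fun w hw => (Finset.mem_filter.1 hw).2
  have htotal : (∑ w ∈ Finset.univ.erase v, #(regularExtensions d (F ⊔ edge v w)) : ℝ≥0∞) =
      d * #(regularExtensions d F) := by
    exact_mod_cast sum_card_regularExtensions_sup_edge d F v
  calc
    _ = _ := sum_regularExtensions_sum_neighborFinset d F v g
    _ ≤ _ := Finset.sum_le_sum hbound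
    _ ≤ b * (d * #(regularExtensions d F)) + #M * (p * (d * #(regularExtensions d F))) := by
      rw [Finset.sum_add_distrib, ← Finset.mul_sum, htotal]
      gcongr
    _ = _ := by ring

end Extensions
section Transcript

variable {n : ℕ} {h : Transcript n}

theorem revealed_adj {a b : Fin n} :
    (revealed h).Adj a b ↔ a ≠ b ∧ (Step.randNeighbor a b ∈ h ∨ Step.randNeighbor b a ∈ h) :=
  SimpleGraph.fromRel_adj ..

theorem revealed_nil : revealed ([] : Transcript n) = ⊥ := by
  ext
  simp [revealed_adj]

theorem revealed_cons_randVertex (h : Transcript n) (w : Fin n) :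
    revealed (.randVertex w :: h) = revealed h := by
  ext
  simp [revealed_adj]

theorem revealed_cons_mark (h : Transcript n) (v : Fin n) :
    revealed (.mark v :: h) = revealed h := by
  ext
  simp [revealed_adj]

theorem revealed_cons_randNeighbor (h : Transcript n) (v w : Fin n) :
    revealed (.randNeighbor v w :: h) = revealed h ⊔ SimpleGraph.edge v w := by
  ext a b
  simp only [revealed_adj, SimpleGraph.sup_adj, SimpleGraph.edge_adj, List.mem_cons,
    Step.randNeighbor.injEq]
  tauto

theorem ncard_edgeSet_revealed_le (h : Transcript n) : (revealed h).edgeSet.ncard ≤ h.length := by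
  induction h with
  | nil => simp [revealed_nil]
  | cons s h ih =>
    cases s with
    | randVertex w => exact revealed_cons_randVertex h w ▸ ih.trans (Nat.le_succ _)
    | mark v => exact revealed_cons_mark h v ▸ ih.trans (Nat.le_succ _)
    | randNeighbor v w =>
      rw [revealed_cons_randNeighbor, SimpleGraph.edgeSet_sup, List.length_cons]
      have hedge : (SimpleGraph.edge v w).edgeSet.ncard ≤ 1 :=
        (Set.ncard_le_ncard SimpleGraph.edgeSet_edge_subset).trans (Set.ncard_singleton _).le
      exact (Set.ncard_union_le _ _).trans (add_le_add ih hedge)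

theorem marked_cons (s : Step n) (h : Transcript n) : marked (s :: h) = s.touched ∪ marked h := by
  ext
  simp [marked]

theorem ncard_touched_le (s : Step n) : s.touched.ncard ≤ 2 := by
  cases s with
  | randNeighbor v w => simpa [Step.touched] using Set.ncard_insert_le v {w}
  | randVertex w => simp [Step.touched]
  | mark v => simp [Step.touched]

theorem ncard_marked_le (h : Transcript n) : (marked h).ncard ≤ 2 * h.length := by
  induction h with
  | nil => simp [marked]
  | cons s h ih =>
    rw [marked_cons, List.length_cons, mul_add_one, add_comm]
    exact (Set.ncard_union_le _ _).trans (add_le_add (ncard_touched_le s) ih)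

theorem mem_marked_of_revealed_adj {a b : Fin n} (hab : (revealed h).Adj a b) : a ∈ marked h := by
  obtain ⟨-, hs | hs⟩ := revealed_adj.1 hab <;> exact ⟨_, hs, by simp [Step.touched]⟩

theorem not_reachable_of_notMem_marked {v w : Fin n} (hvw : v ≠ w) (hw : w ∉ marked h) :
    ¬ (revealed h).Reachable v w := fun hr =>
  have ⟨_, hadj⟩ := hr.symm.nonempty_neighborSet_left hvw.symm
  hw (mem_marked_of_revealed_adj hadj)

theorem neverMerges_cons {s : Step n} :
    NeverMerges (s :: h) ↔
      (∀ v w, s = .randNeighbor v w → ¬ Merges h v w) ∧ NeverMerges h := by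
  simp only [NeverMerges, List.suffix_cons_iff, List.cons.injEq]
  grind

/-- The exploration recorded by a transcript is that of disjoint trees: the revealed edges form a
forest, and no probe has merged two of its trees. -/
def TreeLike (h : Transcript n) : Prop :=
  (revealed h).IsAcyclic ∧ NeverMerges h

theorem treeLike_nil : TreeLike ([] : Transcript n) :=
  ⟨revealed_nil ▸ SimpleGraph.isAcyclic_bot, by simp [NeverMerges]⟩

theorem TreeLike.cons_randVertex (ht : TreeLike h) (w : Fin n) : TreeLike (.randVertex w :: h) :=
  ⟨revealed_cons_randVertex h w ▸ ht.1, neverMerges_cons.2 ⟨by simp, ht.2⟩⟩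

theorem TreeLike.cons_mark (ht : TreeLike h) (v : Fin n) : TreeLike (.mark v :: h) :=
  ⟨revealed_cons_mark h v ▸ ht.1, neverMerges_cons.2 ⟨by simp, ht.2⟩⟩

theorem TreeLike.cons_randNeighbor (ht : TreeLike h) {v w : Fin n} (hvw : v ≠ w)
    (hw : w ∈ marked h → (revealed h).Adj v w) : TreeLike (.randNeighbor v w :: h) := by
  refine ⟨?_, neverMerges_cons.2 ⟨?_, ht.2⟩⟩
  · rw [revealed_cons_randNeighbor]
    by_cases hwm : w ∈ marked h
    · rw [SimpleGraph.sup_edge_of_adj _ (hw hwm)]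
      exact ht.1
    · exact (SimpleGraph.isAcyclic_add_edge_iff_of_not_reachable v w
        (not_reachable_of_notMem_marked hvw hwm)).2 ht.1
  · rintro v w ⟨⟩ ⟨hwm, hreach⟩
    exact hreach (hw hwm).reachable

end Transcript

section PMF

variable {α β ι : Type*}

theorem toOuterMeasure_le_one (p : PMF α) (s : Set α) : p.toOuterMeasure s ≤ 1 := by
  let _ : MeasurableSpace α := ⊤
  exact (p.toOuterMeasure_apply_le_toMeasure_apply s).trans MeasureTheory.prob_le_one

theorem toOuterMeasure_compl (p : PMF α) (s : Set α) :
    p.toOuterMeasure sᶜ = 1 - p.toOuterMeasure s := by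
  let _ : MeasurableSpace α := ⊤
  rw [← p.toMeasure_apply_eq_toOuterMeasure, ← p.toMeasure_apply_eq_toOuterMeasure]
  exact MeasureTheory.prob_compl_eq_one_sub trivial

theorem toOuterMeasure_uniformOfFinset_bind (t : Finset α) (ht : t.Nonempty) (f : α → PMF β)
    (s : Set β) :
    ((PMF.uniformOfFinset t ht).bind f).toOuterMeasure s =
      (#t : ℝ≥0∞)⁻¹ * ∑ a ∈ t, (f a).toOuterMeasure s := by
  rw [PMF.toOuterMeasure_bind_apply, Finset.mul_sum, tsum_eq_sum fun a ha => by
    rw [PMF.uniformOfFinset_apply_of_notMem ht ha, zero_mul]]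
  exact Finset.sum_congr rfl fun a ha => by rw [PMF.uniformOfFinset_apply_of_mem ht ha]

theorem sum_toOuterMeasure_bind_le (p : PMF α) {t : Finset ι} {f : ι → α → PMF β} {s : Set β}
    {B : ℝ≥0∞} (hB : ∀ a, ∑ i ∈ t, (f i a).toOuterMeasure s ≤ B) :
    ∑ i ∈ t, (p.bind (f i)).toOuterMeasure s ≤ B := by
  simp only [PMF.toOuterMeasure_bind_apply]
  rw [← Summable.tsum_finsetSum fun _ _ => ENNReal.summable]
  simp only [← Finset.mul_sum]
  calc
    _ ≤ ∑' a, p a * B := ENNReal.tsum_le_tsum fun a => mul_le_mul_right (hB a) _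
    _ = B := by rw [ENNReal.tsum_mul_right, PMF.tsum_coe, one_mul]

end PMF

section Run

variable {n d : ℕ} [NeZero n]

open Classical in
theorem toOuterMeasure_answer_randNeighbor_bind {β : Type*} {G : SimpleGraph (Fin n)} (hd : 0 < d)
    (hG : G.IsRegularOfDegree d) (v : Fin n) (f : Step n → PMF β) (s : Set β) :
    ((answer G (.randNeighbor v)).bind f).toOuterMeasure s =
      (d : ℝ≥0∞)⁻¹ * ∑ w ∈ G.neighborFinset v, (f (.randNeighbor v w)).toOuterMeasure s := by
  have hcard : #(G.neighborFinset v) = d := hG v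
  have hne : (G.neighborFinset v).Nonempty := Finset.card_pos.1 (hcard ▸ hd)
  rw [answer, dif_pos hne, PMF.bind_map, toOuterMeasure_uniformOfFinset_bind, hcard]
  rfl

theorem sum_answer_randNeighbor_bind_le {β : Type*} (hd : 0 < d) {F : SimpleGraph (Fin n)}
    {M : Finset (Fin n)} {v : Fin n} {f : SimpleGraph (Fin n) → Step n → PMF β} {s : Set β}
    {b p : ℝ≥0∞}
    (hsafe : ∀ w, v ≠ w → (w ∈ M → F.Adj v w) →
      ∑ G ∈ regularExtensions d (F ⊔ SimpleGraph.edge v w),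
        (f G (.randNeighbor v w)).toOuterMeasure s ≤
          b * #(regularExtensions d (F ⊔ SimpleGraph.edge v w)))
    (hrare : ∀ w, v ≠ w → ¬ F.Adj v w →
      (#(regularExtensions d (F ⊔ SimpleGraph.edge v w)) : ℝ≥0∞) ≤
        p * (d * #(regularExtensions d F))) :
    ∑ G ∈ regularExtensions d F, ((answer G (.randNeighbor v)).bind (f G)).toOuterMeasure s ≤
      (b + #M * p) * #(regularExtensions d F) := by
  classical
  calc
    _ = (d : ℝ≥0∞)⁻¹ * ∑ G ∈ regularExtensions d F, ∑ w ∈ G.neighborFinset v,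
          (f G (.randNeighbor v w)).toOuterMeasure s := by
      rw [Finset.mul_sum]
      exact Finset.sum_congr rfl fun G hG =>
        toOuterMeasure_answer_randNeighbor_bind hd (mem_regularExtensions.1 hG).1 v (f G) s
    _ ≤ (d : ℝ≥0∞)⁻¹ * (d * ((b + #M * p) * #(regularExtensions d F))) := by
      gcongr
      exact sum_regularExtensions_sum_neighborFinset_le
        (fun _ _ => toOuterMeasure_le_one _ _) hsafe hrare
    _ = _ := ENNReal.inv_mul_cancel_left (by simpa using hd.ne') (ENNReal.natCast_ne_top d)

theorem card_regularExtensions_revealed_sup_edge_le (hd : 0 < d) {h : Transcript n}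
    (hlen : 16 * h.length ≤ n) {v w : Fin n} (hvw : v ≠ w) (hF : ¬ (revealed h).Adj v w) :
    (#(regularExtensions d (revealed h ⊔ SimpleGraph.edge v w)) : ℝ≥0∞) ≤
      8 / n * (d * #(regularExtensions d (revealed h))) := by
  have hcard : 16 * (revealed h).edgeSet.ncard ≤ Fintype.card (Fin n) := by
    have := ncard_edgeSet_revealed_le h
    rw [Fintype.card_fin]
    lia
  have key := card_mul_card_regularExtensions_sup_edge_le hd hvw hF hcard
  rw [Fintype.card_fin] at key
  rw [← ENNReal.mul_div_right_comm, ENNReal.le_div_iff_mul_le (.inl (by simp [NeZero.ne n]))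
    (.inl (ENNReal.natCast_ne_top n)), mul_comm]
  exact_mod_cast key

/-- At most `2 * Q` vertices are ever marked, and at each step each of them is returned through a
new edge with probability at most `8 / n`. -/
theorem sum_runFrom_not_treeLike_le (hd : 0 < d) (A : Algorithm n) {Q : ℕ} (hQ : 16 * Q ≤ n)
    (q : ℕ) {h : Transcript n} (hlen : h.length + q ≤ Q) (ht : TreeLike h) :
    ∑ G ∈ regularExtensions d (revealed h), (runFrom A G q h).toOuterMeasure {t | ¬ TreeLike t} ≤
      q * (16 * Q / n) * #(regularExtensions d (revealed h)) := by
  classical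
  induction q generalizing h with
  | zero => simp [runFrom, ht]
  | succ q ih =>
    have hmono : q * (16 * Q / n) * #(regularExtensions d (revealed h)) ≤
        (q + 1 : ℕ) * (16 * Q / n : ℝ≥0∞) * #(regularExtensions d (revealed h)) := by
      gcongr
      exact q.le_succ
    simp only [runFrom]
    refine sum_toOuterMeasure_bind_le (A h) fun o => ?_
    rcases o with _ | v | _ | v
    · simp [ht]
    · have hM : #(marked h).toFinset ≤ 2 * Q := by
        have := ncard_marked_le h
        rw [Set.ncard_eq_toFinset_card'] at this
        lia
      refine (sum_answer_randNeighbor_bind_le hd (M := (marked h).toFinset)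
        (b := q * (16 * Q / n)) (p := 8 / n) (fun w hvw hw => ?_)
        (fun w hvw hF => card_regularExtensions_revealed_sup_edge_le hd (by lia) hvw hF)).trans ?_
      · rw [← revealed_cons_randNeighbor]
        exact ih (by rw [List.length_cons]; lia)
          (ht.cons_randNeighbor hvw (by simpa using hw))
      · gcongr
        calc
          _ ≤ q * (16 * Q / n) + (2 * Q : ℕ) * (8 / n : ℝ≥0∞) := by gcongr
          _ = _ := by simp only [div_eq_mul_inv]; push_cast; ring
    · simp only [answer, PMF.bind_map]
      refine sum_toOuterMeasure_bind_le _ fun w => ?_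
      have := ih (by rw [List.length_cons]; lia) (ht.cons_randVertex w)
      rw [revealed_cons_randVertex] at this
      exact this.trans hmono
    · simp only [answer, PMF.pure_bind]
      have := ih (by rw [List.length_cons]; lia) (ht.cons_mark v)
      rw [revealed_cons_mark] at this
      exact this.trans hmono

theorem toOuterMeasure_transcriptLaw_not_treeLike_le (hd : 0 < d)
    (hne : (regularGraphs n d).Nonempty) (A : Algorithm n) (q : ℕ) :
    (transcriptLaw n d hne A q).toOuterMeasure {t | ¬ TreeLike t} ≤ 16 * q ^ 2 / n := by
  rcases le_or_gt (16 * q) n with hq | hq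
  · have key := sum_runFrom_not_treeLike_le hd A hq q (h := []) (by simp) treeLike_nil
    rw [revealed_nil, ← regularGraphs_eq_regularExtensions_bot] at key
    rw [transcriptLaw, toOuterMeasure_uniformOfFinset_bind]
    calc
      _ ≤ (#(regularGraphs n d) : ℝ≥0∞)⁻¹ * (q * (16 * q / n) * #(regularGraphs n d)) := by gcongr
      _ = (#(regularGraphs n d) : ℝ≥0∞)⁻¹ * #(regularGraphs n d) * (16 * q ^ 2 / n) := by
        simp only [div_eq_mul_inv]
        ring
      _ = _ := by
        rw [ENNReal.inv_mul_cancel (by simpa using hne.ne_empty) (ENNReal.natCast_ne_top _),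
          one_mul]
  · refine (toOuterMeasure_le_one _ _).trans ?_
    rw [ENNReal.le_div_iff_mul_le (.inl (by simp [NeZero.ne n]))
      (.inl (ENNReal.natCast_ne_top n)), one_mul]
    have : n ≤ 16 * q ^ 2 := by
      have := Nat.le_self_pow two_ne_zero q
      lia
    exact_mod_cast this

end Run

theorem le_one_sub_of_le_sqrt_div {n q : ℕ} (hq : (q : ℝ) ≤ √n / 60) :
    (995 / 1000 : ℝ≥0∞) ≤ 1 - 16 * q ^ 2 / n := by
  have hqn : 16 * q ^ 2 * 1000 ≤ 5 * n := by
    rw [le_div_iff₀ (by norm_num), Real.le_sqrt (by positivity) (by positivity)] at hq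
    have : (16 * q ^ 2 * 1000 : ℝ) ≤ 5 * n := by nlinarith
    exact_mod_cast this
  have herr : (16 * q ^ 2 / n : ℝ≥0∞) ≤ 5 / 1000 := by
    refine ENNReal.div_le_of_le_mul ?_
    rw [← ENNReal.mul_div_right_comm, ENNReal.le_div_iff_mul_le (by simp) (by simp)]
    exact_mod_cast hqn
  calc
    _ = 1 - (5 / 1000 : ℝ≥0∞) := ENNReal.eq_sub_of_add_eq (by finiteness) <| by
      rw [← ENNReal.add_div, show (995 + 5 : ℝ≥0∞) = 1000 by norm_num]
      exact ENNReal.div_self (by simp) (by simp)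
    _ ≤ _ := tsub_le_tsub_left herr 1

end RegProbe

theorem lemma4p6_general {n d : ℕ} [NeZero n] (hd : 0 < d)
    (hne : (RegProbe.regularGraphs n d).Nonempty) (A : RegProbe.Algorithm n) (q : ℕ) :
    (1 - 16 * q ^ 2 / n : ℝ≥0∞) ≤ (RegProbe.transcriptLaw n d hne A q).toOuterMeasure
      {h | (RegProbe.revealed h).IsAcyclic ∧ RegProbe.NeverMerges h} := by
  change _ ≤ (RegProbe.transcriptLaw n d hne A q).toOuterMeasure {h | RegProbe.TreeLike h}
  rw [← compl_compl {h | RegProbe.TreeLike h}, RegProbe.toOuterMeasure_compl]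
  exact tsub_le_tsub_left (RegProbe.toOuterMeasure_transcriptLaw_not_treeLike_le hd hne A q) 1

theorem lemma4p6 (d : ℕ) (hd : 3 ≤ d) :
    ∃ k : ℝ, 0 < k ∧
      ∀ (n : ℕ) [NeZero n] (hne : (RegProbe.regularGraphs n d).Nonempty)
        (A : RegProbe.Algorithm n) (q : ℕ), (q : ℝ) ≤ Real.sqrt n / k →
        (995 / 1000 : ℝ≥0∞) ≤ (RegProbe.transcriptLaw n d hne A q).toOuterMeasure
          {h | (RegProbe.revealed h).IsAcyclic ∧ RegProbe.NeverMerges h} :=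
  ⟨60, by norm_num, fun _ _ hne A q hq => (RegProbe.le_one_sub_of_le_sqrt_div hq).trans
    (lemma4p6_general (by lia) hne A q)⟩
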